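/- A \emph{space of orderings} is a pair $(X,G)$ where $G$ is an abelian group with a distinguished element $-1$ and $X$ is a nonempty set of characters, i.e. homomorphisms $G\to\{1,-1\}$, with $x(-1)=-1$ for all $x\in X$, such that evaluation $a\mapsto (x\mapsto a(x):=x(a))$ embeds $G$ in $\{1,-1\}^X$, and such that, with $D(a,b)=\{c\in G:\forall x\in X\ (c(x)=a(x)\text{ or }c(x)=b(x))\}$: (1) every character $x$ of $G$ with $x(-1)=-1$ and $D(a,b)\subseteq\ker x$ for all $a,b\in\ker x$ lies in $X$; (2) if $b\in D(a_1,c)$ and $c\in D(a_2,a_3)$, then $b\in D(d,a_3)$ for some $d\in D(a_1,a_2)$. Write $\chi(G)$ for the group of all characters of $G$ with the topology of pointwise convergence, and $\chi(G/H)$ for the subgroup of the characters trivial on a subgroup $H$; put $V^\perp=\{g\in G:\sigma(g)=1\ \forall\sigma\in V\}$ for $V\subseteq\chi(G)$. A \emph{subspace} of $(X,G)$ is a set $Y=\{x\in X: x(a)=1\ \forall a\in A\}$ with $A\subseteq G$; it is identified with the pair $(Y,G/Y^\perp)$. It is a \emph{fan in} $(X,G)$ if $-1\notin Y^\perp$,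 $G/Y^\perp$ has exponent $2$ and $Y$ consists of all characters of $G/Y^\perp$ with value $-1$ at $-1$. Elements $\sigma,\tau\in X$ are \emph{connected}, $\sigma\sim\tau$, if $\sigma=\tau$ or both lie in a four-element fan in $(X,G)$; the \emph{connected component} of $\sigma$ is $\{\tau\in X:\sigma\sim\tau\}$. Let $(X,G)$ be a space of orderings, let $G_0$ be a subgroup of $G$ containing $-1$ (possibly of infinite index), and let $X_0=X|_{G_0}$ be the set of restrictions of the elements of $X$ to $G_0$. Let $S=X^4\cap\chi(G/G_0)$, where $X^4=\{\sigma_1\sigma_2\sigma_3\sigma_4:\sigma_i\in X\}$. For every $\gamma\in S\setminus\{1\}$ choose one or more minimal presentations $\gamma=\sigma_1\cdots\sigma_k$, i.e. with $\sigma_i\in X$ and $k$ as small as possible (then $k=2$ or $4$). The \emph{core} $Y$ is the smallest subspace of $(X,G)$ containing the connected components of all the $\sigma_i$ that occur in the chosen presentations. Put $\Delta=Y^\perp$ and $Y_0=Y|_{G_0}$. \textbf{Theorem.} Suppose that the quotient structure $(X_0,G_0)$ is a space of orderings. Then $S$ generates $\chi(G/G_0)$ as a topological group, i.e. $\chi(G/G_0)$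 is the closure of the subgroup generated by $S$. Moreover $\Delta\subseteq G_0$, and, if $G_0\ne G$, the quotient structure $(Y_0,G_0/\Delta)$ of $(Y,G/\Delta)$ is a space of orderings. (If $G_0=G$, then $S=\{1\}$ and the core is empty.) -/

import Mathlib

/-!  Spaces of orderings: pairs `(X, G)` where `G` is a group with a distinguished element `-1`
(here `ε`) and `X` is a set of characters `G → {1, -1}`. -/

namespace OrderingSpace

/-- The character group `χ(G)`: group homomorphisms `G → {1, -1}`. -/
abbrev Chi (G : Type*) [CommGroup G] : Type _ := G →* ℤˣ

/-- The topology of pointwise convergence on `χ(G)` (with `{1, -1}` discrete). -/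
instance chiTopology (G : Type*) [CommGroup G] : TopologicalSpace (Chi G) :=
  TopologicalSpace.induced (fun (x : Chi G) (g : G) => x g) inferInstance

/-- The value set `D(a, b) = {c | ∀ x ∈ X, c(x) = a(x) or c(x) = b(x)}`. -/
def D {G : Type*} [CommGroup G] (X : Set (Chi G)) (a b : G) : Set G :=
  {c | ∀ x ∈ X, x c = x a ∨ x c = x b}

/-- `(X, G)` is a space of orderings with distinguished element `ε`. Elements of `G` are
functions on `X` via `a(x) = x a`; the field `faithful` says that this makes `G` a subgroup of
`{1, -1} ^ X`, and `G` separates the points of `X` because these are characters of `G`. -/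
structure IsSpaceOfOrderings {G : Type*} [CommGroup G] (ε : G) (X : Set (Chi G)) : Prop where
  nonempty : X.Nonempty
  faithful : ∀ a b : G, (∀ x ∈ X, x a = x b) → a = b
  map_neg_one : ∀ x ∈ X, x ε = -1
  mem_of_ker : ∀ x : Chi G, x ε = -1 →
    (∀ a ∈ x.ker, ∀ b ∈ x.ker, D X a b ⊆ (x.ker : Set G)) → x ∈ X
  assoc : ∀ a₁ a₂ a₃ b c : G, ∃ d : G,
    (b ∈ D X a₁ c ∧ c ∈ D X a₂ a₃) → (b ∈ D X d a₃ ∧ d ∈ D X a₁ a₂)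

/-- The set `X|_H` of restrictions to a subgroup `H` of the characters in `X`. -/
def restrict {G : Type*} [CommGroup G] (X : Set (Chi G)) (H : Subgroup G) : Set (Chi H) :=
  {y | ∃ x ∈ X, y = x.comp H.subtype}

/-- `χ(G/H)`, seen as the subgroup of `χ(G)` of the characters that are trivial on `H`. -/
def chiQuot {G : Type*} [CommGroup G] (H : Subgroup G) : Subgroup (Chi G) where
  carrier := {x | ∀ g ∈ H, x g = 1}
  one_mem' := fun _ _ => rfl
  mul_mem' := fun {x y} hx hy g hg => by
    rw [MonoidHom.mul_apply, hx g hg, hy g hg, one_mul]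
  inv_mem' := fun {x} hx g hg => by
    rw [MonoidHom.inv_apply, hx g hg, inv_one]

/-- `V^⊥`, the subgroup of all `g` with `σ(g) = 1` for all `σ ∈ V`. -/
def perp {G : Type*} [CommGroup G] (V : Set (Chi G)) : Subgroup G where
  carrier := {g | ∀ x ∈ V, x g = 1}
  one_mem' := fun x _ => map_one x
  mul_mem' := fun {a b} ha hb x hx => by rw [map_mul, ha x hx, hb x hx, one_mul]
  inv_mem' := fun {a} ha x hx => by rw [map_inv, ha x hx, inv_one]

/-- `Y` is a subspace of `(X, G)`: an intersection of Harrison sets `{x ∈ X | x(a) = 1}`. -/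
def IsSubspace {G : Type*} [CommGroup G] (X Y : Set (Chi G)) : Prop :=
  ∃ A : Set G, Y = {x | x ∈ X ∧ ∀ a ∈ A, x a = 1}

/-- The smallest subspace of `(X, G)` that contains `T`. -/
def subspaceSpan {G : Type*} [CommGroup G] (X T : Set (Chi G)) : Set (Chi G) :=
  ⋂₀ {Y | IsSubspace X Y ∧ T ⊆ Y}

/-- A set `Y` of characters of `G`, seen as a set of characters of `G/Y^⊥`. -/
def descend {G : Type*} [CommGroup G] (Y : Set (Chi G)) : Set (Chi (G ⧸ perp Y)) :=
  {y | y.comp (QuotientGroup.mk' (perp Y)) ∈ Y}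

/-- `(X, G)` is a fan: `G` has exponent 2, the distinguished element is not `1`, and `X` consists
of all characters that take the value `-1` at the distinguished element. -/
def IsFan {G : Type*} [CommGroup G] (ε : G) (X : Set (Chi G)) : Prop :=
  (∀ g : G, g * g = 1) ∧ ε ≠ 1 ∧ X = {x | x ε = -1}

/-- `V` is a fan in `(X, G)`: a subspace such that `(V, G/V^⊥)` is a fan. -/
def IsFanIn {G : Type*} [CommGroup G] (ε : G) (X V : Set (Chi G)) : Prop :=
  IsSubspace X V ∧ IsFan (QuotientGroup.mk' (perp V) ε) (descend V)

/-- The connectivity relation `σ ∼ τ` on `X`. -/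
def Connected {G : Type*} [CommGroup G] (ε : G) (X : Set (Chi G)) (σ τ : Chi G) : Prop :=
  σ = τ ∨ ∃ V : Set (Chi G), IsFanIn ε X V ∧ V.ncard = 4 ∧ σ ∈ V ∧ τ ∈ V

/-- The connected component of `σ` in `(X, G)`. -/
def component {G : Type*} [CommGroup G] (ε : G) (X : Set (Chi G)) (σ : Chi G) : Set (Chi G) :=
  {τ | τ ∈ X ∧ Connected ε X σ τ}

/-- `S = X⁴ ∩ χ(G/G₀)`. -/
def S {G : Type*} [CommGroup G] (X : Set (Chi G)) (G₀ : Subgroup G) : Set (Chi G) :=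
  {γ | ∃ σ₁ ∈ X, ∃ σ₂ ∈ X, ∃ σ₃ ∈ X, ∃ σ₄ ∈ X, γ = σ₁ * σ₂ * σ₃ * σ₄} ∩ chiQuot G₀

/-- The list `l` is a presentation of `γ` as a product of elements of `X`. -/
def IsPresentation {G : Type*} [CommGroup G] (X : Set (Chi G)) (γ : Chi G)
    (l : List (Chi G)) : Prop :=
  (∀ σ ∈ l, σ ∈ X) ∧ l.prod = γ

/-- A presentation of minimal length. (For `γ ∈ S`, `γ ≠ 1`, the length is then 2 or 4.) -/
def IsMinimalPresentation {G : Type*} [CommGroup G] (X : Set (Chi G)) (γ : Chi G)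
    (l : List (Chi G)) : Prop :=
  IsPresentation X γ l ∧ ∀ l', IsPresentation X γ l' → l.length ≤ l'.length

/-- `P` is a collection of minimal presentations of elements of `S \ {1}`, with at least one
for each such element. It may hold exactly one for each, or all of them. -/
structure IsPresentationSystem {G : Type*} [CommGroup G] (X : Set (Chi G)) (G₀ : Subgroup G)
    (P : Set (List (Chi G))) : Prop where
  minimal : ∀ l ∈ P, ∃ γ ∈ S X G₀, γ ≠ 1 ∧ IsMinimalPresentation X γ l
  covers : ∀ γ ∈ S X G₀, γ ≠ 1 → ∃ l ∈ P, IsMinimalPresentation X γ l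

/-- The core: the subspace generated by the connected components of all the elements of `X` that
occur in the presentations in `P`. -/
def core {G : Type*} [CommGroup G] (ε : G) (X : Set (Chi G)) (P : Set (List (Chi G))) :
    Set (Chi G) :=
  subspaceSpan X (⋃ l ∈ P, ⋃ σ ∈ l, component ε X σ)

end OrderingSpace

/-!
Write `U(a)` for the set of `x ∈ X` with `x a = 1`.

The first assertion is a duality statement: the closure of a subgroup `K` of `χ(G)` consists of all
characters that are trivial on `K^⊥` (`mem_closure_of_trivial_on_perp`), so it says that `S^⊥ ⊆ G₀`. An
element `g ∈ S^⊥` induces a function `f` on `X₀` by `f (x|G₀) = x g`, because a product of two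
elements of `X` that agree on `G₀` lies in `S`. It is continuous, and
`f σ₁ * f σ₂ * f σ₃ * f σ₄ = 1` whenever `σ₁ σ₂ σ₃ σ₄ = 1` in `χ(G₀)`. In a space of orderings each
such function is evaluation at a group element (`IsSpaceOfOrderings.exists_eq_eval`); applied to
`(X₀, G₀)` this gives `h ∈ G₀` with `x g = x h` for all `x ∈ X`, and then `g = h ∈ G₀`.

The representation theorem `exists_eq_eval` is proved by descent to a minimal counterexample. By
compactness there is a subspace `Y` that is minimal among those on which `f` is not given by a group
element. If `p ∈ D(1, e)` on `Y` and `p ≠ 1`, `p ≠ e`, `e ≠ -1` there, then `Y` splits into three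
pieces `U(e)`, `U(p) ∩ U(-e)`, `U(-p)`, and `f` is given by group elements on the union of any two of
them; one application of the associativity axiom glues these elements
(`represented_of_mem_D`). So all value sets over `Y` are trivial and `Y` is a fan. Multiplication by
a product of two elements of `Y` then preserves `Y`, and it carries a representation of `f` on
`U(t) ∩ Y` over to the rest of `Y`, a contradiction.

Associativity over `Y` holds because subspaces of a space of orderings are spaces of orderings. That
rests on the separation theorem `exists_ordering_of_not_mem`: a preordering is the intersection of
the orderings that contain it.

The remaining assertions are formal. Every element of `S` is a product of elements of the core `Y`, so
`Y^⊥ ⊆ S^⊥ ⊆ G₀`. Therefore `Y₀` is cut out of `X₀` by `Y^⊥ ⊆ G₀`, so it is a subspace of the space of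
orderings `(X₀, G₀)`.
-/

namespace OrderingSpace

/-! ### The topology of the character group -/

section Topology

variable {G : Type*} [CommGroup G]

theorem isInducing_coe : Topology.IsInducing (fun (x : Chi G) (g : G) => x g) := ⟨rfl⟩

theorem continuous_eval (g : G) : Continuous (fun x : Chi G => x g) :=
  (continuous_apply g).comp isInducing_coe.continuous

theorem isClosedEmbedding_coe :
    Topology.IsClosedEmbedding (fun (x : Chi G) (g : G) => x g) := by
  refine ⟨⟨isInducing_coe, fun x y h => MonoidHom.ext (congrFun h)⟩, ?_⟩
  have : Set.range (fun (x : Chi G) (g : G) => x g) =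
      ⋂ (a : G) (b : G), {u : G → ℤˣ | u (a * b) = u a * u b} := by
    ext u
    simp only [Set.mem_range, Set.mem_iInter, Set.mem_ofPred_eq]
    constructor
    · rintro ⟨x, rfl⟩ a b
      exact map_mul x a b
    · intro h
      exact ⟨MonoidHom.mk' u h, rfl⟩
  rw [this]
  refine isClosed_iInter fun a => isClosed_iInter fun b => isClosed_eq ?_ ?_
  · exact continuous_apply _
  · exact (continuous_apply a).mul (continuous_apply b)

instance : CompactSpace (Chi G) := isClosedEmbedding_coe.compactSpace

instance : T2Space (Chi G) := isClosedEmbedding_coe.isEmbedding.t2Space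

theorem isClosed_eval_eq (g : G) (u : ℤˣ) : IsClosed {x : Chi G | x g = u} :=
  isClosed_eq (continuous_eval g) continuous_const

theorem isClosed_chiQuot (H : Subgroup G) : IsClosed (chiQuot H : Set (Chi G)) := by
  have : (chiQuot H : Set (Chi G)) = ⋂ g ∈ H, {x : Chi G | x g = 1} := by
    ext x
    simp [chiQuot]
  rw [this]
  exact isClosed_biInter fun g _ => isClosed_eval_eq g 1

theorem continuous_restrict (H : Subgroup G) :
    Continuous (fun x : Chi G => (x.comp H.subtype : Chi H)) :=
  isInducing_coe.continuous_iff.2 (continuous_pi fun h => continuous_eval (h : G))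

theorem mul_self_eq_one (x : Chi G) : x * x = 1 :=
  MonoidHom.ext fun g => Int.units_mul_self (x g)

/-- Finite duality: a character that is trivial on `K^⊥` agrees on every finite set with an element
of the group `K`. -/
theorem exists_mem_eqOn_finset (F : Finset G) : ∀ (K : Subgroup (Chi G)) (χ : Chi G),
    (∀ g ∈ perp (K : Set (Chi G)), χ g = 1) → ∃ s ∈ K, ∀ g ∈ F, s g = χ g := by
  classical
  induction F using Finset.induction_on with
  | empty => exact fun K _ _ => ⟨1, K.one_mem, by simp⟩
  | insert g F _ ih =>
    intro K χ hχ
    by_cases hg : ∀ s ∈ K, s g = 1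
    · obtain ⟨s, hs, h⟩ := ih K χ hχ
      refine ⟨s, hs, fun a ha => ?_⟩
      rcases Finset.mem_insert.1 ha with rfl | ha
      · rw [hg s hs, hχ a hg]
      · exact h a ha
    · push Not at hg
      obtain ⟨s₀, hs₀, h₀⟩ := hg
      have h₀ : s₀ g = -1 := (Int.units_eq_one_or _).resolve_left h₀
      -- the induction hypothesis applies to the stabilizer of `g` in `K`
      let K' : Subgroup (Chi G) := K ⊓ chiQuot (Subgroup.zpowers g)
      have memK' : ∀ s ∈ K, s g = 1 → s ∈ K' := fun s hs h => by
        refine ⟨hs, fun a ha => ?_⟩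
        obtain ⟨n, rfl⟩ := Subgroup.mem_zpowers_iff.1 ha
        rw [map_zpow, h, one_zpow]
      have key : ∀ χ : Chi G, χ g = 1 → (∀ a ∈ perp (K : Set (Chi G)), χ a = 1) →
          ∃ s ∈ K, ∀ a ∈ insert g F, s a = χ a := by
        intro χ hχg hχ
        have hK' : ∀ a ∈ perp (K' : Set (Chi G)), χ a = 1 := by
          intro a ha
          have h1 : ∀ s ∈ K, s g = -1 → s a = s₀ a := fun s hs h => by
            have := ha (s * s₀) (memK' _ (K.mul_mem hs hs₀) (by simp [h, h₀]))
            rw [MonoidHom.mul_apply] at this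
            rcases Int.units_eq_one_or (s a) with h2 | h2 <;>
              rcases Int.units_eq_one_or (s₀ a) with h3 | h3 <;> simp_all
          rcases Int.units_eq_one_or (s₀ a) with h2 | h2
          · refine hχ a fun s hs => ?_
            rcases Int.units_eq_one_or (s g) with h3 | h3
            · exact ha s (memK' s hs h3)
            · rw [h1 s hs h3, h2]
          · have : χ (g * a) = 1 := by
              refine hχ _ fun s hs => ?_
              rcases Int.units_eq_one_or (s g) with h3 | h3
              · rw [map_mul, h3, ha s (memK' s hs h3), one_mul]
              · rw [map_mul, h3, h1 s hs h3, h2]; rfl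
            rwa [map_mul, hχg, one_mul] at this
        obtain ⟨s, hs, h⟩ := ih K' χ hK'
        refine ⟨s, hs.1, fun a ha => ?_⟩
        rcases Finset.mem_insert.1 ha with rfl | ha
        · rw [hχg, hs.2 a (Subgroup.mem_zpowers a)]
        · exact h a ha
      rcases Int.units_eq_one_or (χ g) with h | h
      · exact key χ h hχ
      · obtain ⟨s, hs, h1⟩ := key (χ * s₀) (by simp [h, h₀]) fun a ha => by
          rw [MonoidHom.mul_apply, hχ a ha, ha s₀ hs₀, one_mul]
        refine ⟨s * s₀, K.mul_mem hs hs₀, fun a ha => ?_⟩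
        rw [MonoidHom.mul_apply, h1 a ha, MonoidHom.mul_apply, mul_assoc, Int.units_mul_self,
          mul_one]

theorem mem_closure_of_trivial_on_perp (K : Subgroup (Chi G)) (χ : Chi G)
    (hχ : ∀ g ∈ perp (K : Set (Chi G)), χ g = 1) : χ ∈ closure (K : Set (Chi G)) := by
  rw [mem_closure_iff]
  rintro _ ⟨V, hV, rfl⟩ hχV
  obtain ⟨F, u, hu, hF⟩ := isOpen_pi_iff.1 hV _ hχV
  obtain ⟨s, hs, h⟩ := exists_mem_eqOn_finset F K χ hχ
  refine ⟨s, hF fun g hg => ?_, hs⟩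
  change s g ∈ u g
  rw [h g hg]
  exact (hu g hg).2

theorem perp_subgroupClosure (V : Set (Chi G)) :
    perp (Subgroup.closure V : Set (Chi G)) = perp V := by
  refine le_antisymm (fun g hg x hx => hg x (Subgroup.subset_closure hx)) fun g hg x hx => ?_
  induction hx using Subgroup.closure_induction with
  | mem x hx => exact hg x hx
  | one => rfl
  | mul x y _ _ hx hy => rw [MonoidHom.mul_apply, hx, hy, one_mul]
  | inv x _ hx => rw [MonoidHom.inv_apply, hx, inv_one]

end Topology

/-! ### Value sets and preorderings -/

section Preorderings

variable {G : Type*} [CommGroup G] {ε : G} {X : Set (Chi G)}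

theorem mul_mem_D {a b c : G} (g : G) (h : c ∈ D X a b) : g * c ∈ D X (g * a) (g * b) := by
  intro x hx
  rw [map_mul, map_mul, map_mul]
  exact (h x hx).imp (congrArg _) (congrArg _)

theorem D_comm (a b : G) : D X a b = D X b a := by
  ext c
  exact forall₂_congr fun _ _ => or_comm

theorem IsSpaceOfOrderings.mul_self (hX : IsSpaceOfOrderings ε X) (g : G) : g * g = 1 :=
  hX.faithful _ _ fun x _ => by rw [map_mul, Int.units_mul_self, map_one]

/-- Associativity for sums of four elements, in the form `(a₁ + a₂) + (b₁ + b₂) =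
(a₁ + b₁) + (a₂ + b₂)`. -/
theorem IsSpaceOfOrderings.exists_regroup (hX : IsSpaceOfOrderings ε X) {a₁ a₂ b₁ b₂ p q c : G}
    (hp : p ∈ D X a₁ a₂) (hq : q ∈ D X b₁ b₂) (hc : c ∈ D X p q) :
    ∃ r ∈ D X a₁ b₁, ∃ s ∈ D X a₂ b₂, c ∈ D X r s := by
  obtain ⟨d, h⟩ := hX.assoc p b₁ b₂ c q
  obtain ⟨hcd, hd⟩ := h ⟨hc, hq⟩
  rw [D_comm] at hd hcd
  obtain ⟨r, h⟩ := hX.assoc b₁ a₁ a₂ d p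
  obtain ⟨hdr, hr⟩ := h ⟨hd, hp⟩
  rw [D_comm] at hdr
  obtain ⟨s, h⟩ := hX.assoc b₂ a₂ r c d
  obtain ⟨hcs, hs⟩ := h ⟨hcd, hdr⟩
  exact ⟨r, D_comm b₁ a₁ ▸ hr, s, D_comm b₂ a₂ ▸ hs, D_comm s r ▸ hcs⟩

/-- A subgroup that is closed under value sets. The element `-1` is allowed, in which case the
subgroup is everything. -/
def IsPreordering (X : Set (Chi G)) (T : Subgroup G) : Prop :=
  ∀ a ∈ T, ∀ b ∈ T, D X a b ⊆ (T : Set G)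

/-- The set `T + bT`, the preordering generated by a preordering `T` and an element `b`. -/
def adjoin (hX : IsSpaceOfOrderings ε X) (T : Subgroup G) (hT : IsPreordering X T) (b : G) :
    Subgroup G where
  carrier := {c | ∃ s ∈ T, ∃ t ∈ T, c ∈ D X s (b * t)}
  one_mem' := ⟨1, T.one_mem, 1, T.one_mem, fun _ _ => Or.inl rfl⟩
  mul_mem' := by
    rintro c₁ c₂ ⟨s₁, hs₁, t₁, ht₁, h₁⟩ ⟨s₂, hs₂, t₂, ht₂, h₂⟩
    have hp : c₁ * s₂ ∈ D X (s₁ * s₂) (b * (t₁ * s₂)) := by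
      have := mul_mem_D s₂ h₁
      rwa [mul_comm s₂ c₁, mul_comm s₂ s₁, mul_comm s₂ (b * t₁), mul_assoc b] at this
    have hq : c₁ * (b * t₂) ∈ D X (t₁ * t₂) (b * (s₁ * t₂)) := by
      have := mul_mem_D (b * t₂) h₁
      rw [D_comm] at this
      have e₁ : b * t₂ * (b * t₁) = t₁ * t₂ := by
        rw [mul_mul_mul_comm, hX.mul_self, one_mul, mul_comm]
      have e₂ : b * t₂ * s₁ = b * (s₁ * t₂) := by
        rw [mul_assoc, mul_comm t₂]
      rwa [e₁, e₂, mul_comm (b * t₂) c₁] at this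
    obtain ⟨r, hr, s, hs, hc⟩ := hX.exists_regroup hp hq (mul_mem_D c₁ h₂)
    refine ⟨r, hT _ (T.mul_mem hs₁ hs₂) _ (T.mul_mem ht₁ ht₂) hr, b * s, ?_, ?_⟩
    · refine hT _ (T.mul_mem ht₁ hs₂) _ (T.mul_mem hs₁ ht₂) ?_
      have := mul_mem_D b hs
      rwa [← mul_assoc, ← mul_assoc b b, hX.mul_self, one_mul, one_mul] at this
    · rwa [← mul_assoc, hX.mul_self, one_mul]
  inv_mem' := by
    intro c hc
    rwa [inv_eq_of_mul_eq_one_left (hX.mul_self c)]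

theorem mem_adjoin {hX : IsSpaceOfOrderings ε X} {T : Subgroup G} {hT : IsPreordering X T}
    {b c : G} : c ∈ adjoin hX T hT b ↔ ∃ s ∈ T, ∃ t ∈ T, c ∈ D X s (b * t) := Iff.rfl

theorem le_adjoin (hX : IsSpaceOfOrderings ε X) (T : Subgroup G) (hT : IsPreordering X T) (b : G) :
    T ≤ adjoin hX T hT b :=
  fun s hs => ⟨s, hs, 1, T.one_mem, fun _ _ => Or.inl rfl⟩

theorem self_mem_adjoin (hX : IsSpaceOfOrderings ε X) (T : Subgroup G) (hT : IsPreordering X T)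
    (b : G) : b ∈ adjoin hX T hT b :=
  ⟨1, T.one_mem, 1, T.one_mem, fun _ _ => Or.inr (by rw [mul_one])⟩

theorem isPreordering_adjoin (hX : IsSpaceOfOrderings ε X) (T : Subgroup G)
    (hT : IsPreordering X T) (b : G) : IsPreordering X (adjoin hX T hT b) := by
  rintro p ⟨s₁, hs₁, t₁, ht₁, h₁⟩ q ⟨s₂, hs₂, t₂, ht₂, h₂⟩ c hc
  obtain ⟨r, hr, s, hs, hc⟩ := hX.exists_regroup h₁ h₂ hc
  refine ⟨r, hT _ hs₁ _ hs₂ hr, b * s, hT _ ht₁ _ ht₂ ?_, ?_⟩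
  · have := mul_mem_D b hs
    rwa [← mul_assoc, ← mul_assoc b b, hX.mul_self, one_mul, one_mul] at this
  · rwa [← mul_assoc, hX.mul_self, one_mul]

/-- If `a ∉ T`, the preordering `T - aT` is proper: `-1 = s - at` would give `at ∈ 1 + s`. -/
theorem neg_one_not_mem_adjoin (hX : IsSpaceOfOrderings ε X) (T : Subgroup G)
    (hT : IsPreordering X T) {a : G} (ha : a ∉ T) : ε ∉ adjoin hX T hT (ε * a) := by
  rintro ⟨s, hs, t, ht, h⟩
  refine ha ((T.mul_mem_cancel_right ht).1 (hT 1 T.one_mem s hs fun x hx => ?_))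
  have := h x hx
  simp only [map_mul, hX.map_neg_one x hx, map_one] at this ⊢
  rcases Int.units_eq_one_or (x s) with h1 | h1 <;>
    rcases Int.units_eq_one_or (x a) with h2 | h2 <;>
    rcases Int.units_eq_one_or (x t) with h3 | h3 <;> simp_all

/-- A preordering is the intersection of the orderings that contain it. -/
theorem exists_ordering_of_not_mem (hX : IsSpaceOfOrderings ε X) (T : Subgroup G)
    (hT : IsPreordering X T) {a : G} (ha : a ∉ T) :
    ∃ x ∈ X, (∀ t ∈ T, x t = 1) ∧ x a = -1 := by
  classical
  obtain ⟨M, hTM, hM⟩ := zorn_le_nonempty₀ {T : Subgroup G | IsPreordering X T ∧ ε ∉ T} (by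
      intro c hc hchain y hy
      have hmem : ∀ {g}, g ∈ sSup c ↔ ∃ T ∈ c, g ∈ T :=
        Subgroup.mem_sSup_of_directedOn ⟨y, hy⟩ hchain.directedOn
      refine ⟨sSup c, ⟨fun a ha b hb d hd => ?_, fun h => ?_⟩, fun _ => le_sSup⟩
      · obtain ⟨A, hA, ha⟩ := hmem.1 ha
        obtain ⟨B, hB, hb⟩ := hmem.1 hb
        rcases hchain.total hA hB with h | h
        · exact hmem.2 ⟨B, hB, (hc hB).1 a (h ha) b hb hd⟩
        · exact hmem.2 ⟨A, hA, (hc hA).1 a ha b (h hb) hd⟩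
      · obtain ⟨A, hA, h⟩ := hmem.1 h
        exact (hc hA).2 h)
    (adjoin hX T hT (ε * a)) ⟨isPreordering_adjoin _ _ _ _, neg_one_not_mem_adjoin hX T hT ha⟩
  obtain ⟨⟨hMP, hMε⟩, hmax⟩ := hM
  have hindex : ∀ b, b ∉ M → ε * b ∈ M := fun b hb =>
    hmax ⟨isPreordering_adjoin hX M hMP (ε * b), neg_one_not_mem_adjoin hX M hMP hb⟩
      (le_adjoin hX M hMP _) (self_mem_adjoin hX M hMP _)
  let x : Chi G := MonoidHom.mk' (fun g => if g ∈ M then 1 else -1) (by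
    intro g h
    by_cases hg : g ∈ M
    · simp only [hg, if_true, one_mul, M.mul_mem_cancel_left hg]
    · by_cases hh : h ∈ M
      · simp only [hg, hh, M.mul_mem_cancel_right hh, if_true, if_false, mul_one]
      · have : g * h ∈ M := by
          have := M.mul_mem (hindex g hg) (hindex h hh)
          rwa [mul_mul_mul_comm, hX.mul_self, one_mul] at this
        simp [hg, hh, this])
  have hx : ∀ g, x g = if g ∈ M then 1 else -1 := fun _ => rfl
  have hker : ∀ g, x g = 1 ↔ g ∈ M := fun g => by
    rw [hx]
    by_cases hg : g ∈ M <;> simp [hg]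
  have hxε : x ε = -1 := by rw [hx, if_neg hMε]
  refine ⟨x, hX.mem_of_ker x hxε fun a ha b hb c hc => ?_, fun t ht => ?_, ?_⟩
  · exact (hker c).2 (hMP a ((hker a).1 ha) b ((hker b).1 hb) hc)
  · exact (hker t).2 (hTM (le_adjoin _ _ _ _ ht))
  · have : x (ε * a) = 1 := (hker _).2 (hTM (self_mem_adjoin ..))
    rw [map_mul, hxε] at this
    rcases Int.units_eq_one_or (x a) with h | h <;> simp_all

end Preorderings

/-! ### Subspaces -/

section Subspaces

variable {G : Type*} [CommGroup G] {ε : G} {X Y : Set (Chi G)}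

theorem IsSubspace.subset (hY : IsSubspace X Y) : Y ⊆ X := by
  obtain ⟨A, rfl⟩ := hY
  exact fun _ h => h.1

theorem IsSubspace.mem_iff (hY : IsSubspace X Y) {x : Chi G} :
    x ∈ Y ↔ x ∈ X ∧ ∀ a ∈ perp Y, x a = 1 := by
  refine ⟨fun h => ⟨hY.subset h, fun a ha => ha x h⟩, fun h => ?_⟩
  obtain ⟨A, rfl⟩ := hY
  exact ⟨h.1, fun a ha => h.2 a fun y hy => hy.2 a ha⟩

theorem IsSubspace.isPreordering_perp (hY : IsSubspace X Y) : IsPreordering X (perp Y) := by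
  intro a ha b hb c hc x hx
  rcases hc x (hY.subset hx) with h | h
  · rw [h, ha x hx]
  · rw [h, hb x hx]

theorem D_anti (h : Y ⊆ X) (a b : G) : D X a b ⊆ D Y a b := fun _ hc x hx => hc x (h hx)

/-- Value sets over a subspace `Y` come from value sets over `X` after multiplication by elements
of `Y^⊥`. -/
theorem IsSubspace.exists_mem_D (hX : IsSpaceOfOrderings ε X) (hY : IsSubspace X Y) {a b c : G}
    (hc : c ∈ D Y a b) : ∃ s ∈ perp Y, ∃ r ∈ perp Y, c * s ∈ D X (a * r) b := by
  have hP := hY.isPreordering_perp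
  -- every ordering in `Y` that is negative at `ac` is positive at `bc`
  have hbc : b * c ∈ adjoin hX (perp Y) hP (ε * (a * c)) := by
    by_contra h
    obtain ⟨x, hx, hxT, hxbc⟩ := exists_ordering_of_not_mem hX _ (isPreordering_adjoin _ _ _ _) h
    have hxY : x ∈ Y := hY.mem_iff.2 ⟨hx, fun t ht => hxT t (le_adjoin _ _ _ _ ht)⟩
    have hac := hxT _ (self_mem_adjoin ..)
    have := hc x hxY
    simp only [map_mul, hX.map_neg_one x hx] at hac hxbc
    rcases Int.units_eq_one_or (x a) with h1 | h1 <;>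
      rcases Int.units_eq_one_or (x b) with h2 | h2 <;>
      rcases Int.units_eq_one_or (x c) with h3 | h3 <;> simp_all
  obtain ⟨s, hs, r, hr, h⟩ := mem_adjoin.1 hbc
  refine ⟨s, hs, r, hr, fun x hx => ?_⟩
  have := h x hx
  simp only [map_mul, hX.map_neg_one x hx] at this ⊢
  rcases Int.units_eq_one_or (x a) with h1 | h1 <;>
    rcases Int.units_eq_one_or (x b) with h2 | h2 <;>
    rcases Int.units_eq_one_or (x c) with h3 | h3 <;>
    rcases Int.units_eq_one_or (x r) with h4 | h4 <;>
    rcases Int.units_eq_one_or (x s) with h5 | h5 <;> simp_all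

theorem IsSubspace.assoc (hX : IsSpaceOfOrderings ε X) (hY : IsSubspace X Y) {a₁ a₂ a₃ b c : G}
    (hb : b ∈ D Y a₁ c) (hc : c ∈ D Y a₂ a₃) : ∃ d ∈ D Y a₁ a₂, b ∈ D Y d a₃ := by
  rw [D_comm] at hb
  obtain ⟨s, hs, r, hr, hb⟩ := hY.exists_mem_D hX hb
  obtain ⟨s', hs', r', hr', hc⟩ := hY.exists_mem_D hX hc
  -- after scaling, the same multiple `c * r * s'` of `c` occurs in both relations
  have hb' := mul_mem_D s' hb
  have hc' := mul_mem_D r hc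
  rw [show r * (c * s') = s' * (c * r) by ac_rfl] at hc'
  rw [D_comm] at hb'
  obtain ⟨d, h⟩ := hX.assoc _ _ _ _ _
  obtain ⟨hbd, hd⟩ := h ⟨hb', hc'⟩
  refine ⟨d, fun x hx => ?_, fun x hx => ?_⟩
  · have := hd x (hY.subset hx)
    simpa only [map_mul, hs x hx, hr x hx, hs' x hx, hr' x hx, mul_one, one_mul] using this
  · have := hbd x (hY.subset hx)
    simpa only [map_mul, hs x hx, hr x hx, hs' x hx, hr' x hx, mul_one, one_mul] using this

theorem IsSubspace.mem_of_ker (hX : IsSpaceOfOrderings ε X) (hY : IsSubspace X Y) (x : Chi G)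
    (hε : x ε = -1) (h : ∀ a ∈ x.ker, ∀ b ∈ x.ker, D Y a b ⊆ (x.ker : Set G)) : x ∈ Y := by
  refine hY.mem_iff.2 ⟨hX.mem_of_ker x hε fun a ha b hb =>
    (D_anti hY.subset a b).trans (h a ha b hb), fun a ha => ?_⟩
  exact h 1 (one_mem _) 1 (one_mem _) fun y hy => Or.inl (by rw [ha y hy, map_one])

/-- A nonempty subspace `Y` is a space of orderings over every presentation `π : G → B` of
`G/Y^⊥`. -/
theorem IsSubspace.isSpaceOfOrderings {B : Type*} [CommGroup B] (hX : IsSpaceOfOrderings ε X)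
    (hY : IsSubspace X Y) (hne : Y.Nonempty) (π : G →* B) (hπ : Function.Surjective π)
    (hker : π.ker = perp Y) : IsSpaceOfOrderings (π ε) {y : Chi B | y.comp π ∈ Y} := by
  have hlift : ∀ x ∈ Y, ∃ y : Chi B, y.comp π = x := fun x hx => by
    have hle : π.ker ≤ x.ker := fun g hg => by
      rw [hker] at hg
      exact hg x hx
    exact ⟨π.liftOfSurjective hπ ⟨x, hle⟩, MonoidHom.liftOfRightInverse_comp ..⟩
  have hD : ∀ a b c : G, π c ∈ D {y : Chi B | y.comp π ∈ Y} (π a) (π b) ↔ c ∈ D Y a b := by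
    refine fun a b c => ⟨fun h x hx => ?_, fun h y hy => h _ hy⟩
    obtain ⟨y, rfl⟩ := hlift x hx
    exact h y hx
  refine ⟨?_, ?_, ?_, ?_, ?_⟩
  · obtain ⟨x, hx⟩ := hne
    obtain ⟨y, rfl⟩ := hlift x hx
    exact ⟨y, hx⟩
  · intro a b h
    obtain ⟨a, rfl⟩ := hπ a
    obtain ⟨b, rfl⟩ := hπ b
    rw [← div_eq_one, ← map_div, ← MonoidHom.mem_ker, hker]
    intro x hx
    obtain ⟨y, rfl⟩ := hlift x hx
    rw [map_div, div_eq_one]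
    exact h y hx
  · exact fun y hy => hX.map_neg_one _ (hY.subset hy)
  · refine fun y hε h => hY.mem_of_ker hX _ hε fun a ha b hb c hc => ?_
    exact h (π a) ha (π b) hb ((hD a b c).2 hc)
  · intro a₁ a₂ a₃ b c
    obtain ⟨a₁, rfl⟩ := hπ a₁
    obtain ⟨a₂, rfl⟩ := hπ a₂
    obtain ⟨a₃, rfl⟩ := hπ a₃
    obtain ⟨b, rfl⟩ := hπ b
    obtain ⟨c, rfl⟩ := hπ c
    by_cases h : b ∈ D Y a₁ c ∧ c ∈ D Y a₂ a₃
    · obtain ⟨d, hd, hbd⟩ := hY.assoc hX h.1 h.2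
      exact ⟨π d, fun _ => ⟨(hD ..).2 hbd, (hD ..).2 hd⟩⟩
    · exact ⟨1, fun h' => absurd ⟨(hD ..).1 h'.1, (hD ..).1 h'.2⟩ h⟩

theorem subset_subspaceSpan (T : Set (Chi G)) : T ⊆ subspaceSpan X T :=
  fun _ hx _ hY => hY.2 hx

theorem isSubspace_subspaceSpan {T : Set (Chi G)} (hT : T ⊆ X) :
    IsSubspace X (subspaceSpan X T) := by
  refine ⟨perp (subspaceSpan X T), Set.Subset.antisymm (fun x hx => ⟨?_, fun a ha => ha x hx⟩) ?_⟩
  · exact hx X ⟨⟨∅, by simp⟩, hT⟩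
  · rintro x ⟨hx, h⟩ Z ⟨⟨A, rfl⟩, hZ⟩
    exact ⟨hx, fun a ha => h a fun y hy => (hy _ ⟨⟨A, rfl⟩, hZ⟩).2 a ha⟩

theorem IsSpaceOfOrderings.isClosed (hX : IsSpaceOfOrderings ε X) : IsClosed X := by
  have : X = {x | x ε = -1} ∩ ⋂ (a : G) (b : G) (c : G) (_ : c ∈ D X a b),
      ({x | x a = -1} ∪ {x | x b = -1} ∪ {x : Chi G | x c = 1}) := by
    refine Set.Subset.antisymm (fun x hx => ⟨hX.map_neg_one x hx, ?_⟩) fun x hx => ?_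
    · simp only [Set.mem_iInter, Set.mem_union, Set.mem_ofPred_eq]
      intro a b c hc
      have := hc x hx
      rcases Int.units_eq_one_or (x a) with h1 | h1 <;>
        rcases Int.units_eq_one_or (x b) with h2 | h2 <;> simp_all
    · refine hX.mem_of_ker x hx.1 fun a ha b hb c hc => ?_
      have := hx.2
      simp only [Set.mem_iInter, Set.mem_union, Set.mem_ofPred_eq] at this
      have := this a b c hc
      rw [MonoidHom.mem_ker] at ha hb
      rw [ha, hb] at this
      simpa using this
  rw [this]
  refine (isClosed_eval_eq _ _).inter (isClosed_iInter fun a => isClosed_iInter fun b =>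
    isClosed_iInter fun c => isClosed_iInter fun _ => ?_)
  exact ((isClosed_eval_eq _ _).union (isClosed_eval_eq _ _)).union (isClosed_eval_eq _ _)

end Subspaces

/-! ### Functions represented by group elements -/

section Representation

variable {G : Type*} [CommGroup G] {ε : G} {X Y : Set (Chi G)}

/-- On `Z`, the function `f` is evaluation at an element of `G`. -/
def RepresentedOn (f : Chi G → ℤˣ) (Z : Set (Chi G)) : Prop :=
  ∃ g : G, ∀ x ∈ Z, f x = x g

/-- If a continuous function is not represented on `X`, then by compactness there is a minimal
subspace on which it is not represented. -/
theorem IsSpaceOfOrderings.exists_minimal_not_represented (hX : IsSpaceOfOrderings ε X)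
    {f : Chi G → ℤˣ} (hf : ContinuousOn f X) (h : ¬ RepresentedOn f X) :
    ∃ Y, IsSubspace X Y ∧ ¬ RepresentedOn f Y ∧
      ∀ t ∉ perp Y, RepresentedOn f {x | x ∈ Y ∧ x t = 1} := by
  obtain ⟨A, -, hA, hmax⟩ := zorn_subset_nonempty
    {A : Set G | ¬ RepresentedOn f {x | x ∈ X ∧ ∀ a ∈ A, x a = 1}} (by
      rintro c hc hchain ⟨A₀, hA₀⟩
      refine ⟨⋃₀ c, ?_, fun A => Set.subset_sUnion_of_mem⟩
      rintro ⟨g, hg⟩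
      have : Nonempty c := ⟨⟨A₀, hA₀⟩⟩
      have hclosed : ∀ A : Set G,
          IsClosed ({x | x ∈ X ∧ f x * x g = -1} ∩ {x | ∀ a ∈ A, x a = 1}) := fun A => by
        have h1 : IsClosed (X ∩ (fun x => f x * x g) ⁻¹' {-1}) :=
          (hf.mul (continuous_eval g).continuousOn).preimage_isClosed_of_isClosed hX.isClosed
            (isClosed_discrete _)
        have h2 : IsClosed {x : Chi G | ∀ a ∈ A, x a = 1} := by
          simp only [Set.ofPred_forall]
          exact isClosed_biInter fun a _ => isClosed_eval_eq a 1
        exact h1.inter h2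
      obtain ⟨x, hx⟩ := IsCompact.nonempty_iInter_of_directed_nonempty_isCompact_isClosed
        (fun A : c => {x | x ∈ X ∧ f x * x g = -1} ∩ {x | ∀ a ∈ A.1, x a = 1})
        (by
          rintro ⟨A, hA⟩ ⟨B, hB⟩
          rcases hchain.total hA hB with h | h
          · exact ⟨⟨B, hB⟩, fun x hx => ⟨hx.1, fun a ha => hx.2 a (h ha)⟩, fun _ hx => hx⟩
          · exact ⟨⟨A, hA⟩, fun _ hx => hx, fun x hx => ⟨hx.1, fun a ha => hx.2 a (h ha)⟩⟩)
        (by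
          rintro ⟨A, hA⟩
          have hAc : ¬ ∀ x ∈ {x | x ∈ X ∧ ∀ a ∈ A, x a = 1}, f x = x g := fun h => hc hA ⟨g, h⟩
          push Not at hAc
          obtain ⟨x, hx, hne⟩ := hAc
          refine ⟨x, ⟨hx.1, ?_⟩, hx.2⟩
          rcases Int.units_eq_one_or (f x) with h1 | h1 <;>
            rcases Int.units_eq_one_or (x g) with h2 | h2 <;> simp_all)
        (fun A => (hclosed A).isCompact) (fun A => hclosed A)
      rw [Set.mem_iInter] at hx
      have hxX := (hx ⟨A₀, hA₀⟩).1
      have := hg x ⟨hxX.1, fun a ⟨A, hA, ha⟩ => (hx ⟨A, hA⟩).2 a ha⟩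
      have h1 := hxX.2
      rw [this, Int.units_mul_self] at h1
      exact absurd h1 (by decide))
    ∅ (by simpa using h)
  refine ⟨_, ⟨A, rfl⟩, hA, fun t ht => ?_⟩
  by_contra hn
  have : insert t A ⊆ A := hmax (y := insert t A) (by
    have e : {x : Chi G | x ∈ X ∧ ∀ a ∈ insert t A, x a = 1} =
        {x | x ∈ {x | x ∈ X ∧ ∀ a ∈ A, x a = 1} ∧ x t = 1} := by
      ext x
      simp only [Set.mem_ofPred_eq, Set.forall_mem_insert]
      tauto
    change ¬ RepresentedOn f _
    rwa [e]) (Set.subset_insert t A)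
  exact ht fun x hx => hx.2 t (this (Set.mem_insert t A))

/-- Let `p ∈ D(1, e)` on a subspace `Y`, so that `Y` is the union of the pieces `U(e)`,
`U(p) ∩ U(-e)` and `U(-p)`. If `f` is represented on the union of any two of the pieces, then it
is represented on `Y`. -/
theorem IsSubspace.represented_of_mem_D (hX : IsSpaceOfOrderings ε X) (hY : IsSubspace X Y)
    {f : Chi G → ℤˣ} {e p : G} (hp : p ∈ D Y 1 e)
    (h₁ : RepresentedOn f {x | x ∈ Y ∧ x p = 1})
    (h₂ : RepresentedOn f {x | x ∈ Y ∧ x (ε * e) = 1})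
    (h₃ : RepresentedOn f {x | x ∈ Y ∧ x (p * e) = 1}) : RepresentedOn f Y := by
  obtain ⟨u, hu⟩ := h₁
  obtain ⟨v, hv⟩ := h₂
  obtain ⟨w, hw⟩ := h₃
  have hε : ∀ x ∈ Y, x ε = -1 := fun x hx => hX.map_neg_one x (hY.subset hx)
  -- after multiplication by `u`, the function is `1`, `u * v`, `u * w` on the three unions, and
  -- the associativity axiom is applied to `1 ∈ D(uvp, uw)` and `uw ∈ D(uv, e)`
  obtain ⟨d, hd, h1⟩ := hY.assoc hX (a₁ := u * v * p) (a₂ := u * v) (a₃ := e) (b := 1)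
    (c := u * w)
    (fun x hx => by
      have h0 := hp x hx; have h1 := hu x; have h2 := hv x; have h3 := hw x
      simp only [Set.mem_ofPred_eq, map_mul, map_one, hε x hx, hx, true_and] at h0 h1 h2 h3 ⊢
      generalize f x = y at *
      clear hp hu hv hw hε
      rcases Int.units_eq_one_or (x p) with h4 | h4 <;>
        rcases Int.units_eq_one_or (x e) with h5 | h5 <;>
        simp_all <;>
        rcases Int.units_eq_one_or (x u) with h6 | h6 <;>
        rcases Int.units_eq_one_or (x v) with h7 | h7 <;>
        rcases Int.units_eq_one_or (x w) with h8 | h8 <;> simp_all)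
    (fun x hx => by
      have h0 := hp x hx; have h1 := hu x; have h2 := hv x; have h3 := hw x
      simp only [Set.mem_ofPred_eq, map_mul, map_one, hε x hx, hx, true_and] at h0 h1 h2 h3 ⊢
      generalize f x = y at *
      clear hp hu hv hw hε
      rcases Int.units_eq_one_or (x p) with h4 | h4 <;>
        rcases Int.units_eq_one_or (x e) with h5 | h5 <;>
        simp_all <;>
        rcases Int.units_eq_one_or (x u) with h6 | h6 <;>
        rcases Int.units_eq_one_or (x v) with h7 | h7 <;>
        rcases Int.units_eq_one_or (x w) with h8 | h8 <;> simp_all)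
  -- `d` is `uv` on `U(e)` and `1` on the other two pieces
  refine ⟨d * v, fun x hx => ?_⟩
  have h0 := hp x hx; have h1 := h1 x hx; have h2 := hd x hx; have h3 := hu x; have h9 := hv x
  simp only [Set.mem_ofPred_eq, map_mul, map_one, hε x hx, hx, true_and] at h0 h1 h2 h3 h9 ⊢
  generalize f x = y at *
  clear hp hu hv hw hε hd
  rcases Int.units_eq_one_or (x p) with h4 | h4 <;>
    rcases Int.units_eq_one_or (x e) with h5 | h5 <;> simp_all <;>
    rcases Int.units_eq_one_or (x u) with h6 | h6 <;>
    rcases Int.units_eq_one_or (x v) with h7 | h7 <;>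
    rcases Int.units_eq_one_or (x d) with h8 | h8 <;> simp_all

/-- If all value sets over a subspace `Y` are as small as possible, then `Y` consists of all
characters of `G/Y^⊥` with value `-1` at `-1`. -/
theorem IsSubspace.mem_of_trivial_D (hX : IsSpaceOfOrderings ε X) (hY : IsSubspace X Y)
    (h : ∀ e, ∀ p ∈ D Y 1 e, p ∈ perp Y ∨ p * e ∈ perp Y ∨ ε * e ∈ perp Y) {x : Chi G}
    (hε : x ε = -1) (hx : ∀ g ∈ perp Y, x g = 1) : x ∈ Y := by
  refine hY.mem_of_ker hX x hε fun a ha b hb c hc => ?_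
  have hac : a * c ∈ D Y 1 (a * b) := by
    have := mul_mem_D a hc
    rwa [hX.mul_self] at this
  rw [MonoidHom.mem_ker] at ha hb
  rw [SetLike.mem_coe, MonoidHom.mem_ker]
  rcases h _ _ hac with h1 | h1 | h1 <;> have := hx _ h1 <;>
    simp only [map_mul, ha, hb, hε, one_mul, mul_one] at this
  · exact this
  · exact this
  · exact absurd this (by decide)

/-- A continuous function on a space of orderings is evaluation at a group element if the product of
its values at `σ₁, σ₂, σ₃, σ₄` is `1` whenever `σ₁ σ₂ σ₃ σ₄ = 1`. -/
theorem IsSpaceOfOrderings.exists_eq_eval (hX : IsSpaceOfOrderings ε X) {f : Chi G → ℤˣ}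
    (hf : ContinuousOn f X)
    (h4 : ∀ σ₁ ∈ X, ∀ σ₂ ∈ X, ∀ σ₃ ∈ X, ∀ σ₄ ∈ X, σ₁ * σ₂ * σ₃ * σ₄ = 1 →
      f σ₁ * f σ₂ * f σ₃ * f σ₄ = 1) : RepresentedOn f X := by
  by_contra hn
  obtain ⟨Y, hY, hnY, hmin⟩ := hX.exists_minimal_not_represented hf hn
  have hε : ∀ x ∈ Y, x ε = -1 := fun x hx => hX.map_neg_one x (hY.subset hx)
  have hfan : ∀ {x : Chi G}, x ε = -1 → (∀ g ∈ perp Y, x g = 1) → x ∈ Y := by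
    refine fun {x} => hY.mem_of_trivial_D hX fun e p hp => ?_
    by_contra! h
    refine hnY (hY.represented_of_mem_D hX hp (hmin _ h.1) (hmin _ h.2.2) (hmin _ h.2.1))
  obtain ⟨x₀, hx₀⟩ : Y.Nonempty := by
    by_contra! h
    exact hnY ⟨1, by simp [h]⟩
  have : ∃ y ∈ Y, y ≠ x₀ := by
    by_contra! h
    rcases Int.units_eq_one_or (f x₀) with h1 | h1
    · exact hnY ⟨1, fun x hx => by rw [h x hx, h1, map_one]⟩
    · exact hnY ⟨ε, fun x hx => by rw [h x hx, h1, hε _ hx₀]⟩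
  obtain ⟨y₀, hy₀, hne⟩ := this
  obtain ⟨t, ht⟩ : ∃ t, y₀ t ≠ x₀ t := by
    by_contra! h
    exact hne (MonoidHom.ext h)
  have hγ : ∀ x ∈ Y, x₀ * y₀ * x ∈ Y := fun x hx => by
    refine hfan ?_ fun g hg => ?_
    · simp [hε x hx, hε _ hx₀, hε _ hy₀]
    · simp [hg x hx, hg _ hx₀, hg _ hy₀]
  have ht' : x₀ t * y₀ t = -1 := by
    rw [Int.units_ne_iff_eq_neg.1 ht, mul_neg, Int.units_mul_self]
  have htY : t ∉ perp Y := fun h => ht ((h _ hy₀).trans (h _ hx₀).symm)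
  obtain ⟨g, hg⟩ := hmin t htY
  -- by the condition on fourfold products, the quotient `f (γ x) / f x` with `γ = x₀ y₀` is constant
  have hconst : ∀ x ∈ Y, f x = f (x₀ * y₀ * x) * (f x₀ * f y₀) := fun x hx => by
    have e : x₀ * y₀ * x * x * x₀ * y₀ = 1 := by
      rw [mul_assoc (x₀ * y₀) x x, mul_self_eq_one, mul_one, mul_assoc, mul_self_eq_one]
    have := h4 _ (hY.subset (hγ x hx)) _ (hY.subset hx) _ (hY.subset hx₀) _ (hY.subset hy₀) e
    rw [mul_assoc, mul_right_comm, mul_eq_one_iff_eq_inv, Int.units_inv_eq_self] at this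
    exact this.symm
  have hneg : ∀ x ∈ Y, x t = -1 → f x = x g * (x₀ g * y₀ g * (f x₀ * f y₀)) := fun x hx hxt => by
    rw [hconst x hx, hg _ ⟨hγ x hx, by
      rw [MonoidHom.mul_apply, MonoidHom.mul_apply, ht', hxt, Int.units_mul_self]⟩]
    simp only [MonoidHom.mul_apply]
    ac_rfl
  rcases Int.units_eq_one_or (x₀ g * y₀ g * (f x₀ * f y₀)) with hc | hc
  · refine hnY ⟨g, fun x hx => ?_⟩
    rcases Int.units_eq_one_or (x t) with h | h
    · exact hg x ⟨hx, h⟩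
    · rw [hneg x hx h, hc, mul_one]
  · refine hnY ⟨g * t, fun x hx => ?_⟩
    rcases Int.units_eq_one_or (x t) with h | h
    · rw [hg x ⟨hx, h⟩, map_mul, h, mul_one]
    · rw [hneg x hx h, hc, map_mul, h]

end Representation

/-! ### Quotient structures -/

section Quotients

variable {G : Type*} [CommGroup G] {ε : G} {X : Set (Chi G)}

/-- The key fact about quotient structures: if `(X₀, G₀)` is a space of orderings, then
`S^⊥ ⊆ G₀`. -/
theorem perp_S_le (hX : IsSpaceOfOrderings ε X) {G₀ : Subgroup G} (hε : ε ∈ G₀)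
    (hX₀ : IsSpaceOfOrderings (⟨ε, hε⟩ : G₀) (restrict X G₀)) : perp (S X G₀) ≤ G₀ := by
  classical
  intro g hg
  -- `f (x|G₀) = x g`, with value `1` outside `X₀`
  let f : Chi G₀ → ℤˣ := fun y =>
    if h : ∃ x ∈ X, y = x.comp G₀.subtype then h.choose g else 1
  have hprod : ∀ σ₁ ∈ X, ∀ σ₂ ∈ X, ∀ σ₃ ∈ X, ∀ σ₄ ∈ X, (∀ a ∈ G₀, (σ₁ * σ₂ * σ₃ * σ₄) a = 1) →
      σ₁ g * σ₂ g * σ₃ g * σ₄ g = 1 := fun σ₁ h₁ σ₂ h₂ σ₃ h₃ σ₄ h₄ h =>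
    hg _ ⟨⟨σ₁, h₁, σ₂, h₂, σ₃, h₃, σ₄, h₄, rfl⟩, h⟩
  have hf : ∀ x ∈ X, f (x.comp G₀.subtype) = x g := fun x hx => by
    have h : ∃ z ∈ X, x.comp G₀.subtype = z.comp G₀.subtype := ⟨x, hx, rfl⟩
    have hfx : f (x.comp G₀.subtype) = h.choose g := dif_pos h
    obtain ⟨hz, hxz⟩ := h.choose_spec
    rw [hfx]
    have := hprod x hx _ hz x hx x hx fun a ha => by
      have hxa : x a = h.choose a := DFunLike.congr_fun hxz ⟨a, ha⟩
      simp only [MonoidHom.mul_apply, hxa, Int.units_mul_self, one_mul]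
    rw [mul_assoc, Int.units_mul_self, mul_one, mul_eq_one_iff_eq_inv, Int.units_inv_eq_self] at this
    exact this.symm
  have hcont : ContinuousOn f (restrict X G₀) := by
    rw [continuousOn_iff_isClosed]
    intro t _
    -- the part of `X₀` on which `f` lies in `t` is the image of a compact part of `X`
    refine ⟨(fun x : Chi G => (x.comp G₀.subtype : Chi G₀)) '' (X ∩ (fun x => x g) ⁻¹' t), ?_, ?_⟩
    · have hcl : IsClosed (X ∩ (fun x : Chi G => x g) ⁻¹' t) :=
        hX.isClosed.inter ((isClosed_discrete t).preimage (continuous_eval g))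
      exact (hcl.isCompact.image (continuous_restrict G₀)).isClosed
    · ext y
      constructor
      · rintro ⟨hy, x, hx, rfl⟩
        refine ⟨⟨x, ⟨hx, ?_⟩, rfl⟩, x, hx, rfl⟩
        rwa [Set.mem_preimage, hf x hx] at hy
      · rintro ⟨⟨x, ⟨hx, hxt⟩, rfl⟩, hy⟩
        refine ⟨?_, hy⟩
        rw [Set.mem_preimage, hf x hx]
        exact hxt
  obtain ⟨h, hh⟩ := hX₀.exists_eq_eval hcont (by
    rintro _ ⟨σ₁, h₁, rfl⟩ _ ⟨σ₂, h₂, rfl⟩ _ ⟨σ₃, h₃, rfl⟩ _ ⟨σ₄, h₄, rfl⟩ h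
    rw [hf _ h₁, hf _ h₂, hf _ h₃, hf _ h₄]
    exact hprod _ h₁ _ h₂ _ h₃ _ h₄ fun a ha => DFunLike.congr_fun h ⟨a, ha⟩)
  have : g = h := hX.faithful _ _ fun x hx => by
    rw [← hf x hx, hh _ ⟨x, hx, rfl⟩]
    rfl
  rw [this]
  exact h.2

theorem core_generators_subset (P : Set (List (Chi G))) :
    (⋃ l ∈ P, ⋃ σ ∈ l, component ε X σ) ⊆ X := by
  simp only [Set.iUnion_subset_iff]
  exact fun _ _ _ _ _ h => h.1

theorem perp_core_le_perp_S {G₀ : Subgroup G} {P : Set (List (Chi G))}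
    (hP : IsPresentationSystem X G₀ P) : perp (core ε X P) ≤ perp (S X G₀) := by
  intro g hg γ hγ
  by_cases h1 : γ = 1
  · rw [h1, MonoidHom.one_apply]
  obtain ⟨l, hl, ⟨hlX, rfl⟩, -⟩ := hP.covers γ hγ h1
  have : ∀ σ ∈ l, σ g = 1 := fun σ hσ => hg σ <| subset_subspaceSpan _ <|
    Set.mem_biUnion hl <| Set.mem_biUnion hσ ⟨hlX σ hσ, Or.inl rfl⟩
  have key : ∀ l : List (Chi G), (∀ σ ∈ l, σ g = 1) → l.prod g = 1 := by
    intro l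
    induction l with
    | nil => exact fun _ => rfl
    | cons σ l ih =>
      intro h
      rw [List.prod_cons, MonoidHom.mul_apply, h σ (by simp),
        ih fun τ hτ => h τ (List.mem_cons_of_mem σ hτ), one_mul]
  exact key l this

/-- If `Y^⊥ ⊆ G₀`, then `Y₀` is a subspace of `X₀`, cut out by `Y^⊥`; so `(Y₀, G₀/Y^⊥)` is a space
of orderings if `(X₀, G₀)` is. -/
theorem isSpaceOfOrderings_restrict_descend {G₀ : Subgroup G} (hε : ε ∈ G₀)
    (hX₀ : IsSpaceOfOrderings (⟨ε, hε⟩ : G₀) (restrict X G₀)) {Y : Set (Chi G)}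
    (hY : IsSubspace X Y) (hne : Y.Nonempty) (hle : perp Y ≤ G₀) :
    IsSpaceOfOrderings
      (⟨QuotientGroup.mk' (perp Y) ε, Subgroup.mem_map_of_mem _ hε⟩ :
        G₀.map (QuotientGroup.mk' (perp Y)))
      (restrict (descend Y) (G₀.map (QuotientGroup.mk' (perp Y)))) := by
  have hY₀ : IsSubspace (restrict X G₀) (restrict Y G₀) := by
    refine ⟨{a | (a : G) ∈ perp Y}, Set.Subset.antisymm ?_ ?_⟩
    · rintro _ ⟨x, hx, rfl⟩
      exact ⟨⟨x, hY.subset hx, rfl⟩, fun a ha => ha x hx⟩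
    · rintro _ ⟨⟨x, hx, rfl⟩, h⟩
      exact ⟨x, hY.mem_iff.2 ⟨hx, fun a ha => h ⟨a, hle ha⟩ ha⟩, rfl⟩
  have hne₀ : (restrict Y G₀).Nonempty := by
    obtain ⟨x, hx⟩ := hne
    exact ⟨_, x, hx, rfl⟩
  let π := (QuotientGroup.mk' (perp Y)).subgroupMap G₀
  have hπ : Function.Surjective π := MonoidHom.subgroupMap_surjective _ _
  have hker : π.ker = perp (restrict Y G₀) := by
    ext a
    have : π a = 1 ↔ (a : G) ∈ perp Y := by
      rw [Subtype.ext_iff]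
      exact QuotientGroup.eq_one_iff _
    rw [MonoidHom.mem_ker, this]
    constructor
    · rintro h _ ⟨x, hx, rfl⟩
      exact h x hx
    · exact fun h x hx => h _ ⟨x, hx, rfl⟩
  have hset : restrict (descend Y) (G₀.map (QuotientGroup.mk' (perp Y))) =
      {y | y.comp π ∈ restrict Y G₀} := by
    ext y
    constructor
    · rintro ⟨x, hx, rfl⟩
      exact ⟨_, hx, rfl⟩
    · rintro ⟨x, hx, hyx⟩
      have hxY : perp Y ≤ x.ker := fun a ha => ha x hx
      refine ⟨QuotientGroup.lift (perp Y) x hxY, ?_, ?_⟩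
      · change _ ∈ Y
        have e : (QuotientGroup.lift (perp Y) x hxY).comp (QuotientGroup.mk' (perp Y)) = x :=
          MonoidHom.ext fun _ => rfl
        rwa [e]
      · refine MonoidHom.ext fun b => ?_
        obtain ⟨a, rfl⟩ := hπ b
        exact DFunLike.congr_fun hyx a
  rw [hset]
  exact hY₀.isSpaceOfOrderings hX₀ hne₀ π hπ hker

end Quotients

end OrderingSpace

theorem mainTheorem9 {G : Type*} [CommGroup G] (ε : G) (X : Set (OrderingSpace.Chi G))
    (hX : OrderingSpace.IsSpaceOfOrderings ε X)
    (G₀ : Subgroup G) (hε : ε ∈ G₀)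
    -- the quotient structure of `(X, G)` given by `G₀` is a space of orderings
    (hX₀ : OrderingSpace.IsSpaceOfOrderings (⟨ε, hε⟩ : G₀) (OrderingSpace.restrict X G₀))
    (P : Set (List (OrderingSpace.Chi G)))
    (hP : OrderingSpace.IsPresentationSystem X G₀ P)
    (Y : Set (OrderingSpace.Chi G)) (hY : Y = OrderingSpace.core ε X P) :
    closure (Subgroup.closure (OrderingSpace.S X G₀) : Set (OrderingSpace.Chi G)) =
        (OrderingSpace.chiQuot G₀ : Set (OrderingSpace.Chi G)) ∧
      OrderingSpace.perp Y ≤ G₀ ∧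
      (G₀ ≠ ⊤ →
        OrderingSpace.IsSpaceOfOrderings
          (⟨QuotientGroup.mk' (OrderingSpace.perp Y) ε, Subgroup.mem_map_of_mem _ hε⟩ :
            G₀.map (QuotientGroup.mk' (OrderingSpace.perp Y)))
          (OrderingSpace.restrict (OrderingSpace.descend Y)
            (G₀.map (QuotientGroup.mk' (OrderingSpace.perp Y))))) := by
  subst hY
  have hperp := OrderingSpace.perp_S_le hX hε hX₀
  have hle : OrderingSpace.perp (OrderingSpace.core ε X P) ≤ G₀ :=
    (OrderingSpace.perp_core_le_perp_S hP).trans hperp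
  refine ⟨Set.Subset.antisymm ?_ fun χ hχ => ?_, hle, fun hG₀ => ?_⟩
  · refine closure_minimal ?_ (OrderingSpace.isClosed_chiQuot G₀)
    exact (Subgroup.closure_le _).2 fun γ hγ => hγ.2
  · refine OrderingSpace.mem_closure_of_trivial_on_perp _ χ fun g hg => hχ g (hperp ?_)
    rwa [OrderingSpace.perp_subgroupClosure] at hg
  · refine OrderingSpace.isSpaceOfOrderings_restrict_descend hε hX₀
      (OrderingSpace.isSubspace_subspaceSpan (OrderingSpace.core_generators_subset P)) ?_ hle
    -- an empty core has orthogonal complement `G`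
    by_contra h
    rw [Set.not_nonempty_iff_eq_empty] at h
    replace h : OrderingSpace.core ε X P = ∅ := h
    exact hG₀ (top_le_iff.1 fun g _ => hle (by
      rw [h]
      exact fun x hx => absurd hx (Set.notMem_empty x)))
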